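/- Let $\mathcal W=W(2,2)$ be the complex Lie algebra with basis $\{L_n,W_n,z : n\in\mathbb Z\}$ and brackets $$[L_n,L_m]=(m-n)L_{m+n}+\tfrac{n^3-n}{12}\delta_{m+n,0}\,z,\qquad [L_n,W_m]=(m-n)W_{m+n}+\tfrac{n^3-n}{12}\delta_{m+n,0}\,z,$$ $$[W_n,W_m]=[z,W_m]=[z,L_m]=0,$$ let $\mathcal W_+=\mathrm{Span}_{\mathbb C}\{L_n,W_n : n>0\}$, and let $S(z)=\mathbb C[z]$, viewed in the centre of the enveloping algebra $\mathcal U(\mathcal W)$. Let $\varphi:\mathcal W_+\to\mathbb C$ be a Lie algebra homomorphism that is non-singular, i.e. $\varphi(L_i)\varphi(W_i)\neq 0$ for $i=1,2$. A vector $v$ of a $\mathcal W$-module is a Whittaker vector of type $\varphi$ if $xv=\varphi(x)v$ for all $x\in\mathcal W_+$, and a $\mathcal W$-module is a Whittaker module of type $\varphi$ if it is generated by a Whittaker vector of type $\varphi$. Let $M_\varphi=\mathcal U(\mathcal W)\otimes_{\mathcal U(\mathcal W_+)}\mathbb C_\varphi$, where $\mathbb C_\varphi$ is the one-dimensional $\mathcal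 W_+$-module on which $\mathcal W_+$ acts through $\varphi$. (1) Every nonzero submodule of a Whittaker module of type $\varphi$ contains a nonzero submodule that is itself a Whittaker module of type $\varphi$. (2) For every submodule $N$ of $M_\varphi$ there is an ideal $I$ of $S(z)$ such that $N=IM_\varphi$. -/

import Mathlib

open scoped TensorProduct

noncomputable section

namespace W22

attribute [local instance 100] LieRing.ofAssociativeRing

/-- Labels of the standard basis of the W-algebra: `L n`, `W n` for an integer `n`, and `z`. -/
inductive Label : Type
  | L (n : ℤ)
  | W (n : ℤ)
  | z

/-- The underlying complex vector space of the W-algebra `W(2,2)`, with basis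
`L n`, `W n` (`n` an integer) and `z`. -/
def Alg : Type := Label →₀ ℂ

instance : AddCommGroup Alg := inferInstanceAs (AddCommGroup (Label →₀ ℂ))
instance : Module ℂ Alg := inferInstanceAs (Module ℂ (Label →₀ ℂ))

/-- The basis vector with a given label. -/
def vec (i : Label) : Alg := Finsupp.single i (1 : ℂ)

/-- The basis of the W-algebra. -/
def basis : Module.Basis Label ℂ Alg := Finsupp.basisSingleOne

theorem basis_apply (i : Label) : basis i = vec i := by
  unfold basis; rfl

def L (n : ℤ) : Alg := vec (Label.L n)
def W (n : ℤ) : Alg := vec (Label.W n)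
def z : Alg := vec Label.z

/-- The coefficient `(n ^ 3 - n) / 12 * δ_{m + n, 0}` of the central element. -/
def cocycle (n m : ℤ) : ℂ := if m + n = 0 then ((n : ℂ) ^ 3 - (n : ℂ)) / 12 else 0

/-- The brackets of the basis vectors. -/
def bracketBasis : Label → Label → Alg
  | .L n, .L m => ((m : ℂ) - (n : ℂ)) • L (m + n) + cocycle n m • z
  | .L n, .W m => ((m : ℂ) - (n : ℂ)) • W (m + n) + cocycle n m • z
  | .W n, .L m => -(((n : ℂ) - (m : ℂ)) • W (n + m) + cocycle m n • z)
  | .W _, .W _ => 0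
  | .z, _ => 0
  | _, .z => 0

/-- The bilinear extension of `bracketBasis`. -/
def bracket : Alg →ₗ[ℂ] Alg →ₗ[ℂ] Alg :=
  basis.constr ℂ fun i => basis.constr ℂ fun j => bracketBasis i j

theorem bracket_vec (i j : Label) : bracket (vec i) (vec j) = bracketBasis i j := by
  rw [← basis_apply, ← basis_apply]
  simp [bracket]

theorem cocycle_swap (n m : ℤ) : cocycle m n = -cocycle n m := by
  unfold cocycle
  by_cases h : m + n = 0
  · have h' : n + m = 0 := by omega
    have : m = -n := by omega
    subst this
    simp; ring
  · have h' : ¬ n + m = 0 := by omega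
    simp [h, h']

theorem bracketBasis_swap (i j : Label) : bracketBasis i j = -bracketBasis j i := by
  rcases i with n | n | _ <;> rcases j with m | m | _ <;> simp only [bracketBasis, neg_neg, neg_zero]
  rw [cocycle_swap n m, add_comm m n]
  module

theorem bracket_swap (x y : Alg) : bracket x y = -bracket y x := by
  have : bracket = -bracket.flip := by
    refine basis.ext fun i => basis.ext fun j => ?_
    simp only [basis_apply, LinearMap.neg_apply, LinearMap.flip_apply, bracket_vec]
    exact bracketBasis_swap i j
  exact LinearMap.congr_fun₂ this x y

theorem cocycle_jacobi (a b c : ℤ) :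
    ((c : ℂ) - b) * cocycle a (c + b) =
      ((b : ℂ) - a) * cocycle (b + a) c + ((c : ℂ) - a) * cocycle b (c + a) := by
  unfold cocycle
  by_cases h : c + b + a = 0
  · have h1 : c + (b + a) = 0 := by omega
    have h2 : c + a + b = 0 := by omega
    have : c = -a - b := by omega
    subst this
    simp only [h, h1, h2, if_true]
    push_cast
    ring
  · have h1 : ¬ c + (b + a) = 0 := by omega
    have h2 : ¬ c + a + b = 0 := by omega
    simp [h, h1, h2]

theorem bracketBasis_leibniz (i j k : Label) :
    bracket (vec i) (bracketBasis j k) =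
      bracket (bracketBasis i j) (vec k) + bracket (vec j) (bracketBasis i k) := by
  rcases i with a | a | _ <;> rcases j with b | b | _ <;> rcases k with c | c | _ <;>
    simp only [bracketBasis, L, W, z, map_add, map_neg, map_smul, map_zero, LinearMap.add_apply,
      LinearMap.neg_apply, LinearMap.smul_apply, LinearMap.zero_apply, bracket_vec, smul_zero,
      neg_zero, add_zero, zero_add, smul_add, smul_neg, smul_smul, neg_add_rev, neg_neg]
  · have e1 : c + b + a = c + (b + a) := by ring
    have e2 : c + a + b = c + (b + a) := by ring
    rw [e1, e2, cocycle_jacobi a b c]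
    push_cast
    module
  · have e1 : c + b + a = c + (b + a) := by ring
    have e2 : c + a + b = c + (b + a) := by ring
    rw [e1, e2, cocycle_jacobi a b c]
    push_cast
    module
  · have e1 : b + c + a = b + a + c := by ring
    have e2 : b + (c + a) = b + a + c := by ring
    have e3 := cocycle_jacobi a c b
    rw [e1, e2, e3]
    push_cast
    module
  · have e1 : a + (c + b) = a + b + c := by ring
    have e2 : a + c + b = a + b + c := by ring
    have e3 : ((c : ℂ) - b) * cocycle (c + b) a =
        ((a : ℂ) - c) * cocycle b (a + c) - ((a : ℂ) - b) * cocycle c (a + b) := by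
      rw [cocycle_jacobi b c a]; ring
    rw [e1, e2, e3]
    push_cast
    module

theorem bracket_leibniz (x y w : Alg) :
    bracket x (bracket y w) = bracket (bracket x y) w + bracket y (bracket x w) := by
  have h1 : ∀ i j, bracket (vec i) ∘ₗ bracket (vec j) =
      bracket (bracket (vec i) (vec j)) + bracket (vec j) ∘ₗ bracket (vec i) := by
    intro i j
    refine basis.ext fun k => ?_
    simp only [basis_apply, LinearMap.comp_apply, LinearMap.add_apply, bracket_vec]
    exact bracketBasis_leibniz i j k
  have h2 : ∀ i, bracket (vec i) ∘ₗ bracket.flip w =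
      bracket.flip w ∘ₗ bracket (vec i) + bracket.flip (bracket (vec i) w) := by
    intro i
    refine basis.ext fun j => ?_
    simpa only [basis_apply, LinearMap.comp_apply, LinearMap.add_apply, LinearMap.flip_apply]
      using LinearMap.congr_fun (h1 i j) w
  have h3 : bracket.flip (bracket y w) =
      bracket.flip w ∘ₗ bracket.flip y + bracket y ∘ₗ bracket.flip w := by
    refine basis.ext fun i => ?_
    simpa only [basis_apply, LinearMap.comp_apply, LinearMap.add_apply, LinearMap.flip_apply]
      using LinearMap.congr_fun (h2 i) y
  simpa only [LinearMap.comp_apply, LinearMap.add_apply, LinearMap.flip_apply]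
    using LinearMap.congr_fun h3 x

instance : LieRing Alg where
  bracket x y := bracket x y
  add_lie x y w := by simp
  lie_add x y w := by simp
  lie_self x := by
    have h : bracket x x = -bracket x x := bracket_swap x x
    have h2 : (2 : ℂ) • bracket x x = 0 := by
      rw [two_smul]; exact eq_neg_iff_add_eq_zero.mp h
    exact (smul_eq_zero.mp h2).resolve_left two_ne_zero
  leibniz_lie x y w := bracket_leibniz x y w

instance : LieAlgebra ℂ Alg where
  lie_smul c x y := map_smul (bracket x) c y

theorem vec_lie (i j : Label) : ⁅vec i, vec j⁆ = bracketBasis i j := bracket_vec i j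

/-- The span of the `L n` and `W n` with `n > 0`, as a Lie subalgebra. -/
def Pos : LieSubalgebra ℂ Alg where
  __ := Submodule.span ℂ {x : Alg | ∃ n : ℤ, 0 < n ∧ (x = L n ∨ x = W n)}
  lie_mem' := by
    intro x y hx hy
    let S : Submodule ℂ Alg := Submodule.span ℂ {x : Alg | ∃ n : ℤ, 0 < n ∧ (x = L n ∨ x = W n)}
    have hL : ∀ n : ℤ, 0 < n → L n ∈ S := fun n hn => Submodule.subset_span ⟨n, hn, Or.inl rfl⟩
    have hW : ∀ n : ℤ, 0 < n → W n ∈ S := fun n hn => Submodule.subset_span ⟨n, hn, Or.inr rfl⟩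
    change bracket x y ∈ S
    change x ∈ S at hx
    change y ∈ S at hy
    have hc : ∀ n m : ℤ, 0 < n → 0 < m → cocycle n m = 0 := by
      intro n m hn hm
      exact if_neg (by omega)
    induction hx, hy using Submodule.span_induction₂ with
    | mem_mem x y hx hy =>
      obtain ⟨n, hn, rfl | rfl⟩ := hx <;> obtain ⟨m, hm, rfl | rfl⟩ := hy <;>
        simp only [L, W, bracket_vec, bracketBasis, hc n m hn hm, hc m n hm hn, zero_smul,
          add_zero]
      · exact S.smul_mem _ (hL _ (by omega))
      · exact S.smul_mem _ (hW _ (by omega))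
      · exact S.neg_mem (S.smul_mem _ (hW _ (by omega)))
      · exact S.zero_mem
    | zero_left y hy => simp
    | zero_right x hx => simp
    | add_left x y z _ _ _ h1 h2 => simpa using S.add_mem h1 h2
    | add_right x y z _ _ _ h1 h2 => simpa using S.add_mem h1 h2
    | smul_left r x y _ _ h => simpa using S.smul_mem r h
    | smul_right r x y _ _ h => simpa using S.smul_mem r h

/-- `L n` as an element of the positive part. -/
def posL (n : ℤ) (hn : 0 < n) : Pos := ⟨L n, Submodule.subset_span ⟨n, hn, Or.inl rfl⟩⟩

/-- `W n` as an element of the positive part. -/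
def posW (n : ℤ) (hn : 0 < n) : Pos := ⟨W n, Submodule.subset_span ⟨n, hn, Or.inr rfl⟩⟩

/-- A Lie algebra homomorphism from the positive part to `ℂ` is non-singular if it does not
vanish on any of `L 1`, `W 1`, `L 2`, `W 2`. -/
def NonSingular (φ : LieAlgebra.LieCharacter ℂ Pos) : Prop :=
  φ (posL 1 one_pos) * φ (posW 1 one_pos) ≠ 0 ∧ φ (posL 2 two_pos) * φ (posW 2 two_pos) ≠ 0

section Modules

variable {V : Type*} [AddCommGroup V] [Module ℂ V] [LieRingModule Alg V]

/-- Whittaker vectors of type `φ`. -/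
def IsWhittakerVector (φ : LieAlgebra.LieCharacter ℂ Pos) (v : V) : Prop :=
  ∀ x : Pos, ⁅(x : Alg), v⁆ = φ x • v

variable (V) in
/-- A Whittaker module of type `φ` is a module generated by a Whittaker vector of type `φ`,
where `φ` is non-singular. -/
def IsWhittakerModule (φ : LieAlgebra.LieCharacter ℂ Pos) : Prop :=
  NonSingular φ ∧ ∃ v : V, IsWhittakerVector φ v ∧ LieSubmodule.lieSpan ℂ Alg {v} = ⊤

end Modules

/-- The universal enveloping algebra of the W-algebra. -/
abbrev U : Type := UniversalEnvelopingAlgebra ℂ Alg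

/-- The canonical map from the W-algebra to its universal enveloping algebra. -/
abbrev ι : Alg →ₗ⁅ℂ⁆ U := UniversalEnvelopingAlgebra.ι ℂ

/-- The universal enveloping algebra of the positive part. -/
abbrev UPos : Type := UniversalEnvelopingAlgebra ℂ Pos

/-- The algebra homomorphism of enveloping algebras induced by the inclusion of the
positive part. -/
def inclU : UPos →ₐ[ℂ] U :=
  UniversalEnvelopingAlgebra.lift ℂ (ι.comp Pos.incl)

/-- The extension of a character `φ` to the enveloping algebra; it gives the action
on the one-dimensional module `ℂ_φ`. -/
def charU (φ : LieAlgebra.LieCharacter ℂ Pos) : UPos →ₐ[ℂ] ℂ :=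
  UniversalEnvelopingAlgebra.lift ℂ φ

/-- The relations `u a ⊗ c = u ⊗ a c`, where `a` in the enveloping algebra of the positive part
acts on `c` in `ℂ_φ`. -/
def tensorRel (φ : LieAlgebra.LieCharacter ℂ Pos) : Submodule U (U ⊗[ℂ] ℂ) :=
  Submodule.span U {t | ∃ (u : U) (a : UPos) (c : ℂ),
    t = (u * inclU a) ⊗ₜ[ℂ] c - u ⊗ₜ[ℂ] (charU φ a * c)}

/-- The induced module `M_φ`, that is, the tensor product over the enveloping algebra of the
positive part of `U` and `ℂ_φ`. -/
def Universal (φ : LieAlgebra.LieCharacter ℂ Pos) : Type := (U ⊗[ℂ] ℂ) ⧸ tensorRel φ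

variable (φ : LieAlgebra.LieCharacter ℂ Pos)

instance : AddCommGroup (Universal φ) := inferInstanceAs (AddCommGroup ((U ⊗[ℂ] ℂ) ⧸ tensorRel φ))
instance : Module U (Universal φ) := inferInstanceAs (Module U ((U ⊗[ℂ] ℂ) ⧸ tensorRel φ))
instance : Module ℂ (Universal φ) := inferInstanceAs (Module ℂ ((U ⊗[ℂ] ℂ) ⧸ tensorRel φ))
instance : IsScalarTower ℂ U (Universal φ) :=
  inferInstanceAs (IsScalarTower ℂ U ((U ⊗[ℂ] ℂ) ⧸ tensorRel φ))

instance : LieRingModule Alg (Universal φ) where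
  bracket x m := ι x • m
  add_lie x y m := by simp only [map_add, add_smul]
  lie_add x m n := smul_add (ι x) m n
  leibniz_lie x y m := by
    change ι x • ι y • m = ι ⁅x, y⁆ • m + ι y • ι x • m
    rw [LieHom.map_lie, LieRing.of_associative_ring_bracket, sub_smul, mul_smul, mul_smul,
      sub_add_cancel]

instance : LieModule ℂ Alg (Universal φ) where
  smul_lie c x m := by
    change ι (c • x) • m = c • ι x • m
    rw [map_smul, smul_assoc]
  lie_smul c x m := by
    change ι x • c • m = c • ι x • m
    rw [← algebraMap_smul U c m, ← mul_smul, ← Algebra.commutes, mul_smul, algebraMap_smul]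

/-- The subspace `I M_φ` of `M_φ` for an ideal `I` of the algebra of polynomials in `z`,
where a polynomial `p` acts as the element `p(z)` of the enveloping algebra. -/
def idealMul (I : Ideal (Polynomial ℂ)) : Submodule ℂ (Universal φ) :=
  Submodule.span ℂ {m | ∃ p ∈ I, ∃ v : Universal φ, m = Polynomial.aeval (ι z) p • v}

end W22

end

/-! In a module generated by a Whittaker vector `w`, give `L (-k)` and `W (-k)`, `k ≥ 0`, weight `k
+ 2`, and `z` weight 0. A character of the positive part vanishes in degrees at least 3, since these
are spanned by brackets. The shift by 2 then ensures that a generator of degree `n > 0`, minus its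
character value, lowers weight by at least `n` (`gen_lie_word`). Hence a nonzero vector of least
weight in a submodule is a Whittaker vector, which gives (1).

For (2), letters commute up to lower weight (`word_perm`), so a leading part behaves like a
polynomial in commuting letters with coefficients in `ℂ[z]`. Order the letters with every `W` before
every `L`, then by `k`. If `(b, k)` is the largest letter, the generator of the opposite kind and
degree `k + 2`, minus its value, acts to leading order as the nonzero multiple `-(2k + 2) φ(W 2)` of
the partial derivative in that letter (`gen_lie_word_leading`). Repeated differentiation isolates
coefficients: for a vector of `N`, each leading coefficient `p` satisfies `p(z) w ∈ N`
(`coeff_mem`). Subtracting the leading part and descending on weight gives `N = I M_φ` with `I = {p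
| p(z) w ∈ N}`. Working modulo `N` throughout avoids any freeness (PBW) statement. -/

open scoped TensorProduct

noncomputable section

namespace W22

attribute [local instance 100] LieRing.ofAssociativeRing

open Polynomial

/-! ### Brackets of generators -/

/-- The generator `L n` (for `true`) or `W n` (for `false`). -/
def gen (b : Bool) (n : ℤ) : Alg := if b then L n else W n

/-- Most weight estimates use only the degree of a bracket and whether `z` can occur, so the four
kinds of bracket are treated at once. -/
theorem exists_gen_lie (b b' : Bool) (n m : ℤ) : ∃ (b'' : Bool) (c c' : ℂ),
    ⁅gen b n, gen b' m⁆ = c • gen b'' (n + m) + c' • z ∧ (n + m ≠ 0 → c' = 0) := by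
  have h0 : ∀ n m : ℤ, n + m ≠ 0 → cocycle n m = 0 := fun n m h => if_neg (by omega)
  have h0' : ∀ n m : ℤ, n + m ≠ 0 → cocycle m n = 0 := fun n m h => if_neg (by omega)
  rcases b with _ | _ <;> rcases b' with _ | _
  · exact ⟨false, 0, 0, by simp [gen, W, vec_lie, bracketBasis], fun _ => rfl⟩
  · refine ⟨false, -((n : ℂ) - m), -cocycle m n, ?_, fun h => by simp [h0' n m h]⟩
    simp only [gen, W, L, Bool.false_eq_true, if_false, if_true, vec_lie, bracketBasis]
    module
  · refine ⟨false, (m : ℂ) - n, cocycle n m, ?_, h0 n m⟩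
    simp [gen, W, L, vec_lie, bracketBasis, add_comm]
  · refine ⟨true, (m : ℂ) - n, cocycle n m, ?_, h0 n m⟩
    simp [gen, L, vec_lie, bracketBasis, add_comm]

theorem gen_false_lie (n m : ℤ) : ⁅gen false n, gen false m⁆ = 0 := by
  simp [gen, W, vec_lie, bracketBasis]

/-- The top-degree bracket of `gen (!b) (k + 2)` with `gen b (-k)` is a multiple of `W 2`. -/
theorem gen_not_lie (b : Bool) (k : ℕ) :
    ⁅gen (!b) (k + 2), gen b (-k)⁆ = (-(2 * k + 2) : ℂ) • gen false 2 := by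
  rcases b with _ | _
  · have : cocycle (k + 2 : ℤ) (-k) = 0 := if_neg (by omega)
    simp only [gen, Bool.not_false, if_true, Bool.false_eq_true, if_false]
    rw [L, W, vec_lie, bracketBasis, this, zero_smul, add_zero, show (-k + (k + 2) : ℤ) = 2 by ring]
    push_cast
    congr 1
    ring
  · have : cocycle (-k : ℤ) (k + 2) = 0 := if_neg (by omega)
    simp only [gen, Bool.not_true, if_true, Bool.false_eq_true, if_false]
    rw [L, W, vec_lie, bracketBasis, this, zero_smul, add_zero, show ((k : ℤ) + 2 + -k : ℤ) = 2 by ring, ← neg_smul]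
    push_cast
    congr 1
    ring

theorem z_lie (x : Alg) : ⁅z, x⁆ = 0 := by
  have : bracket z = 0 := basis.ext fun i => by
    rw [basis_apply, z, bracket_vec]
    rcases i with _ | _ | _ <;> simp [bracketBasis]
  exact LinearMap.congr_fun this x

theorem alg_induction {p : Alg → Prop} (hgen : ∀ b n, p (gen b n)) (hz : p z) (h0 : p 0)
    (hadd : ∀ x y, p x → p y → p (x + y)) (hsmul : ∀ (c : ℂ) x, p x → p (c • x)) (x : Alg) :
    p x := by
  have hx : x ∈ Submodule.span ℂ (Set.range basis) := by rw [basis.span_eq]; trivial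
  induction hx using Submodule.span_induction with
  | mem x hx =>
    obtain ⟨i, rfl⟩ := hx
    rw [basis_apply]
    rcases i with n | n | _
    · exact hgen true n
    · exact hgen false n
    · exact hz
  | zero => exact h0
  | add x y _ _ hx hy => exact hadd x y hx hy
  | smul c x _ hx => exact hsmul c x hx

/-! ### Words in the nonpositive generators and the weight filtration -/

section Words

variable {V : Type*} [AddCommGroup V] [Module ℂ V] [LieRingModule Alg V] [LieModule ℂ Alg V]

variable (V) in
/-- The action of the central element. -/
def zEnd : Module.End ℂ V := LieModule.toEnd ℂ Alg V z

theorem zEnd_apply (v : V) : zEnd V v = ⁅z, v⁆ := rfl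

/-- Since `z` is central, polynomials in it are module endomorphisms and can be moved through words
onto the generating vector. -/
theorem aeval_zEnd_lie (p : ℂ[X]) (x : Alg) (v : V) :
    aeval (zEnd V) p ⁅x, v⁆ = ⁅x, aeval (zEnd V) p v⁆ := by
  have h : Commute (zEnd V) (LieModule.toEnd ℂ Alg V x) := LinearMap.ext fun u => by
    change ⁅z, ⁅x, u⁆⁆ = ⁅x, ⁅z, u⁆⁆
    rw [leibniz_lie, z_lie, zero_lie, zero_add]
  have h' : Commute (aeval (zEnd V) p) (LieModule.toEnd ℂ Alg V x) := by
    induction p using Polynomial.induction_on' with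
    | add p q hp hq => rw [map_add]; exact hp.add_left hq
    | monomial n a =>
      rw [aeval_monomial]
      exact (Algebra.commute_algebraMap_left _ _).mul_left (h.pow_left n)
  exact LinearMap.congr_fun h'.eq v

theorem aeval_zEnd_mem (N : LieSubmodule ℂ Alg V) (p : ℂ[X]) {v : V} (hv : v ∈ N) :
    aeval (zEnd V) p v ∈ N := by
  induction p using Polynomial.induction_on' with
  | add p q hp hq => rw [map_add]; exact N.add_mem hp hq
  | monomial n a =>
    rw [aeval_monomial, Module.End.mul_apply, Module.algebraMap_end_apply]
    refine N.smul_mem _ ?_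
    induction n with
    | zero => simpa using hv
    | succ n ih => rw [pow_succ', Module.End.mul_apply, zEnd_apply]; exact N.lie_mem ih

/-- The ordered product of the generators `gen b (-k)`, for `(b, k)` in a list, applied to a
vector. -/
def word (l : List (Bool × ℕ)) (v : V) : V := l.foldr (fun j v => ⁅gen j.1 (-j.2), v⁆) v

omit [Module ℂ V] [LieModule ℂ Alg V] in
@[simp] theorem word_nil (v : V) : word [] v = v := rfl

omit [Module ℂ V] [LieModule ℂ Alg V] in
@[simp] theorem word_cons (j : Bool × ℕ) (l : List (Bool × ℕ)) (v : V) :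
    word (j :: l) v = ⁅gen j.1 (-j.2), word l v⁆ := rfl

omit [Module ℂ V] [LieModule ℂ Alg V] in
theorem word_add (l : List (Bool × ℕ)) (u v : V) : word l (u + v) = word l u + word l v := by
  induction l with
  | nil => rfl
  | cons j l ih => rw [word_cons, ih, lie_add]; rfl

theorem word_smul (l : List (Bool × ℕ)) (c : ℂ) (v : V) : word l (c • v) = c • word l v := by
  induction l with
  | nil => rfl
  | cons j l ih => rw [word_cons, ih, lie_smul]; rfl

omit [LieModule ℂ Alg V] in
theorem word_mem (N : LieSubmodule ℂ Alg V) (l : List (Bool × ℕ)) {v : V} (hv : v ∈ N) :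
    word l v ∈ N := by
  induction l with
  | nil => exact hv
  | cons j l ih => exact N.lie_mem ih

theorem aeval_zEnd_word (p : ℂ[X]) (l : List (Bool × ℕ)) (v : V) :
    aeval (zEnd V) p (word l v) = word l (aeval (zEnd V) p v) := by
  induction l with
  | nil => rfl
  | cons j l ih => rw [word_cons, aeval_zEnd_lie, ih, word_cons]

/-- The weight of a list of generators: `L (-k)` and `W (-k)` have weight `k + 2`. -/
def wt (l : List (Bool × ℕ)) : ℕ := (l.map fun j => j.2 + 2).sum

@[simp] theorem wt_nil : wt [] = 0 := rfl

@[simp] theorem wt_cons (j : Bool × ℕ) (l : List (Bool × ℕ)) : wt (j :: l) = j.2 + 2 + wt l := by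
  simp [wt]

theorem wt_perm {l l' : List (Bool × ℕ)} (h : l.Perm l') : wt l = wt l' := (h.map _).sum_eq

/-- The span of the vectors `word l (p(z) w)` with `l` of weight at most `d`. -/
def filt (w : V) (d : ℤ) : Submodule ℂ V :=
  Submodule.span ℂ {v | ∃ (l : List (Bool × ℕ)) (p : ℂ[X]), (wt l : ℤ) ≤ d ∧
    v = word l (aeval (zEnd V) p w)}

variable (w : V)

theorem word_mem_filt (l : List (Bool × ℕ)) (p : ℂ[X]) {d : ℤ} (h : (wt l : ℤ) ≤ d) :
    word l (aeval (zEnd V) p w) ∈ filt w d := Submodule.subset_span ⟨l, p, h, rfl⟩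

theorem filt_mono {d e : ℤ} (h : d ≤ e) : filt w d ≤ filt w e :=
  Submodule.span_mono fun _ ⟨l, p, hl, hv⟩ => ⟨l, p, hl.trans h, hv⟩

/-- Integer indices allow `filt` to be lowered below zero; this is where descents on weight end. -/
theorem filt_eq_bot {d : ℤ} (h : d < 0) : filt w d = ⊥ := by
  refine (Submodule.span_eq_bot).2 ?_
  rintro _ ⟨l, p, hl, rfl⟩
  omega

theorem mem_filt_zero : w ∈ filt w 0 := by
  simpa using word_mem_filt w [] 1 (d := 0) (by simp)

theorem map_filt_le (f : V →ₗ[ℂ] V) {d : ℤ} {S : Submodule ℂ V}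
    (h : ∀ (l : List (Bool × ℕ)) (p : ℂ[X]), (wt l : ℤ) ≤ d →
      f (word l (aeval (zEnd V) p w)) ∈ S) {v : V} (hv : v ∈ filt w d) : f v ∈ S := by
  have : filt w d ≤ S.comap f := by
    refine Submodule.span_le.2 ?_
    rintro _ ⟨l, p, hl, rfl⟩
    exact h l p hl
  exact this hv

/-- The action of `z` is absorbed into the polynomial coefficient, so it costs no weight. -/
theorem zEnd_mem_filt {d : ℤ} {v : V} (hv : v ∈ filt w d) : ⁅z, v⁆ ∈ filt w d :=
  map_filt_le w (zEnd V) (fun l p hl => by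
    have := word_mem_filt w l (X * p) hl
    rwa [map_mul, aeval_X, Module.End.mul_apply, ← aeval_X (R := ℂ) (zEnd V),
      ← aeval_zEnd_word, aeval_X] at this) hv

theorem gen_neg_mem_filt (j : Bool × ℕ) {d e : ℤ} {v : V} (hv : v ∈ filt w d)
    (h : d + j.2 + 2 ≤ e) : ⁅gen j.1 (-j.2), v⁆ ∈ filt w e :=
  map_filt_le w (LieModule.toEnd ℂ Alg V _) (fun l p hl => by
    change word (j :: l) _ ∈ _
    exact word_mem_filt w _ p (by rw [wt_cons]; push_cast; omega)) hv

/-- Reordering a word does not change it modulo words of smaller weight. -/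
theorem word_perm {l l' : List (Bool × ℕ)} (h : l.Perm l') (p : ℂ[X]) :
    word l (aeval (zEnd V) p w) - word l' (aeval (zEnd V) p w) ∈ filt w (wt l - 1) := by
  induction h with
  | nil => simp
  | cons j _ ih =>
    rw [word_cons, word_cons, ← lie_sub, wt_cons]
    exact gen_neg_mem_filt w j ih (by push_cast; omega)
  | swap i j l =>
    obtain ⟨b, c, c', h, -⟩ := exists_gen_lie j.1 i.1 (-j.2) (-i.2)
    rw [word_cons, word_cons, word_cons, word_cons, leibniz_lie, add_sub_cancel_right, h, add_lie,
      smul_lie, smul_lie]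
    have hl := word_mem_filt w l p (le_refl (wt l : ℤ))
    -- The commutator replaces two letters of total weight `j.2 + i.2 + 4` by one of weight `j.2 +
    -- i.2 + 2`, or by `z`.
    refine add_mem (Submodule.smul_mem _ _ ?_) (Submodule.smul_mem _ _ ?_)
    · have := gen_neg_mem_filt w (b, j.2 + i.2) (e := wt (j :: i :: l) - 1) hl
        (by rw [wt_cons, wt_cons]; push_cast; omega)
      rwa [show -((b, j.2 + i.2).2 : ℤ) = -j.2 + -i.2 by push_cast; ring] at this
    · exact filt_mono w (by rw [wt_cons, wt_cons]; push_cast; omega) (zEnd_mem_filt w hl)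
  | @trans l₁ l₂ l₃ h₁ _ ih₁ ih₂ =>
    rw [← wt_perm h₁] at ih₂
    rw [← sub_add_sub_cancel _ (word l₂ (aeval (zEnd V) p w))]
    exact add_mem ih₁ ih₂

/-- Every vector of weight at most `d` is, modulo smaller weight, a combination of one word for
each multiset of generators of weight `d`. -/
theorem exists_sum_words (d : ℕ) {v : V} (hv : v ∈ filt w d) :
    ∃ (A : Finset (Multiset (Bool × ℕ))) (p : Multiset (Bool × ℕ) → ℂ[X]),
      (∀ s ∈ A, wt s.toList = d) ∧
      v - ∑ s ∈ A, word s.toList (aeval (zEnd V) (p s) w) ∈ filt w (d - 1) := by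
  let T : (Multiset (Bool × ℕ) →₀ ℂ[X]) →ₗ[ℂ] V := Finsupp.lsum ℂ fun s =>
    { toFun := fun p => word s.toList (aeval (zEnd V) p w)
      map_add' := fun p q => by rw [map_add, LinearMap.add_apply, word_add]
      map_smul' := fun c p => by rw [map_smul, LinearMap.smul_apply, word_smul, RingHom.id_apply] }
  have hle : filt w d ≤ (Finsupp.supported ℂ[X] ℂ {s | wt s.toList = d}).map T ⊔
      filt w (d - 1) := by
    refine Submodule.span_le.2 ?_
    rintro _ ⟨l, p, hl, rfl⟩
    rcases hl.lt_or_eq with h | h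
    · exact Submodule.mem_sup_right (word_mem_filt w l p (by omega))
    · have hp : l.Perm (l : Multiset (Bool × ℕ)).toList := by
        rw [← Multiset.coe_eq_coe, Multiset.coe_toList]
      have h1 := word_perm w hp p
      rw [h] at h1
      refine Submodule.mem_sup.2 ⟨_, ⟨Finsupp.single l p, ?_, ?_⟩, _, h1, add_sub_cancel _ _⟩
      · refine Finsupp.single_mem_supported _ _ ?_
        have := wt_perm hp
        change wt _ = d
        omega
      · simp only [T, Finsupp.lsum_single]; rfl
  obtain ⟨_, ⟨f, hf, rfl⟩, u, hu, rfl⟩ := Submodule.mem_sup.1 (hle hv)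
  refine ⟨f.support, f, fun s hs => hf hs, ?_⟩
  have : T f = ∑ s ∈ f.support, word s.toList (aeval (zEnd V) (f s) w) := by
    simp [T, Finsupp.sum]
  rwa [← this, add_sub_cancel_left]

/-! ### Positive generators on the filtration, and leading coefficients -/

section Whittaker

variable {w} {χ : Bool → ℤ → ℂ} (hχ : ∀ b n, 0 < n → ⁅gen b n, w⁆ = χ b n • w)
  (hχ₀ : ∀ b n, 3 ≤ n → χ b n = 0)
include hχ hχ₀

/-- By the Leibniz rule it suffices to weigh the bracket with one letter; the cases depend on the
sign of its degree `n - j.2`. -/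
theorem gen_lie_word (l : List (Bool × ℕ)) (p : ℂ[X]) (b : Bool) (n : ℤ) (hn : 0 < n) :
    ⁅gen b n, word l (aeval (zEnd V) p w)⁆ - χ b n • word l (aeval (zEnd V) p w) ∈
      filt w (wt l - n) := by
  induction l generalizing b n with
  | nil => simp [← aeval_zEnd_lie, hχ b n hn]
  | cons j l ih =>
    obtain ⟨b', c, c', h, h'⟩ := exists_gen_lie b j.1 n (-j.2)
    have hl := word_mem_filt w l p (le_refl (wt l : ℤ))
    rw [word_cons, leibniz_lie, add_sub_assoc, ← lie_smul, ← lie_sub, wt_cons]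
    refine add_mem ?_ (gen_neg_mem_filt w j (ih b n hn) (by push_cast; omega))
    rw [h, add_lie, smul_lie, smul_lie]
    refine add_mem (Submodule.smul_mem _ _ ?_) ?_
    -- For `n ≤ j.2` the new letter is `n` lighter than the old. Otherwise it is a positive
    -- generator, and induction applies.
    · rcases le_or_gt n j.2 with hj | hj
      · obtain ⟨k, hk⟩ := Int.le.dest hj
        have := gen_neg_mem_filt w (b', k) (e := (j.2 + 2 + wt l : ℕ) - n) hl
          (by push_cast; omega)
        rwa [show -((b', k).2 : ℤ) = n + -j.2 by push_cast; omega] at this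
      · rw [← sub_add_cancel ⁅gen b' (n + -j.2), _⁆
          (χ b' (n + -j.2) • word l (aeval (zEnd V) p w))]
        refine add_mem (filt_mono w (by push_cast; omega) (ih b' (n + -j.2) (by omega))) ?_
        -- A nonzero scalar requires `n ≤ j.2 + 2`, and then the loss of the letter `j` already
        -- accounts for `n`.
        by_cases h3 : 3 ≤ n + -j.2
        · rw [hχ₀ _ _ h3, zero_smul]; exact zero_mem _
        · exact Submodule.smul_mem _ _ (filt_mono w (by push_cast; omega) hl)
    · by_cases h0 : n + -j.2 = 0
      · exact Submodule.smul_mem _ _ (filt_mono w (by push_cast; omega) (zEnd_mem_filt w hl))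
      · rw [h' h0, zero_smul]; exact zero_mem _

theorem gen_lie_filt (b : Bool) (n : ℤ) (hn : 0 < n) {d : ℤ} {v : V} (hv : v ∈ filt w d) :
    ⁅gen b n, v⁆ - χ b n • v ∈ filt w (d - n) :=
  map_filt_le w (LieModule.toEnd ℂ Alg V (gen b n) - χ b n • LinearMap.id)
    (fun l p hl => filt_mono w (by omega) (gen_lie_word hχ hχ₀ l p b n hn)) hv

/-- To leading order, `gen (!b) (k + 2) - χ` acts on words in generators not exceeding
`(b, k)` as a multiple of the partial derivative with respect to `(b, k)`. -/
theorem gen_lie_word_leading (a : Bool × ℕ) (l : List (Bool × ℕ))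
    (hl : ∀ j ∈ l, toLex j ≤ toLex a) (p : ℂ[X]) :
    ⁅gen (!a.1) (a.2 + 2), word l (aeval (zEnd V) p w)⁆
        - χ (!a.1) (a.2 + 2) • word l (aeval (zEnd V) p w)
        - ((l.count a : ℂ) * (-(2 * a.2 + 2) * χ false 2)) •
          word (l.erase a) (aeval (zEnd V) p w) ∈ filt w (wt l - (a.2 + 2) - 1) := by
  induction l with
  | nil => simp [← aeval_zEnd_lie, hχ _ (a.2 + 2 : ℤ) (by omega)]
  | cons j l ih =>
    have ih := ih fun i hi => hl i (List.mem_cons_of_mem _ hi)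
    have hj := hl j List.mem_cons_self
    have hF := word_mem_filt w l p (le_refl (wt l : ℤ))
    set C : ℂ := -(2 * a.2 + 2) * χ false 2 with hC
    set m : ℤ := a.2 + 2 with hm
    set y := gen (!a.1) m with hy
    set v := word l (aeval (zEnd V) p w) with hv
    have ih' : ⁅gen j.1 (-j.2), ⁅y, v⁆⁆ - χ (!a.1) m • ⁅gen j.1 (-j.2), v⁆
        - ((l.count a : ℂ) * C) • word (j :: l.erase a) (aeval (zEnd V) p w)
        ∈ filt w (wt (j :: l) - m - 1) := by
      rw [word_cons, ← lie_smul, ← lie_smul, ← lie_sub, ← lie_sub, wt_cons]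
      exact gen_neg_mem_filt w j ih (by push_cast; omega)
    rw [word_cons, ← hv, leibniz_lie]
    by_cases hja : j = a
    · subst hja
      have h1 : ⁅⁅y, gen j.1 (-j.2)⁆, v⁆ - C • v ∈ filt w (wt (j :: l) - m - 1) := by
        rw [hy, hm, gen_not_lie, smul_lie, hC, mul_smul, ← smul_sub]
        exact Submodule.smul_mem _ _ (filt_mono w (by rw [wt_cons]; push_cast; omega)
          (gen_lie_word hχ hχ₀ l p false 2 two_pos))
      -- If `j` recurs in `l`, erasing that later copy and keeping the head gives a reordering of
      -- `l`; otherwise the coefficient is zero.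
      have h2 : ((l.count j : ℂ) * C) • (word (j :: l.erase j) (aeval (zEnd V) p w) - v) ∈
          filt w (wt (j :: l) - m - 1) := by
        by_cases h : j ∈ l
        · have hp := (List.perm_cons_erase h).symm
          refine Submodule.smul_mem _ _ (filt_mono w ?_ (word_perm w hp p))
          rw [wt_perm hp, wt_cons]; push_cast; omega
        · simp [List.count_eq_zero_of_not_mem h]
      rw [List.erase_cons_head, List.count_cons_self, ← hv]
      convert add_mem (add_mem ih' h1) h2 using 1
      push_cast
      module
    · have h1 : ⁅⁅y, gen j.1 (-j.2)⁆, v⁆ ∈ filt w (wt (j :: l) - m - 1) := by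
        -- A smaller letter of the other kind is a `W` met by `y`, also a `W`, and they commute. One
        -- of the same kind has smaller index, so its bracket with `y` has degree at least 3, where
        -- `χ` vanishes.
        rcases Prod.Lex.le_iff.1 hj with h | ⟨h, h'⟩
        · obtain ⟨j1, j2⟩ := j
          obtain ⟨a1, a2⟩ := a
          obtain ⟨rfl, rfl⟩ : j1 = false ∧ a1 = true := Bool.lt_iff.1 h
          rw [hy]
          simp [gen_false_lie]
        · change j.1 = a.1 at h
          change j.2 ≤ a.2 at h'
          have h'' : j.2 < a.2 := lt_of_le_of_ne h' fun e => hja (Prod.ext h e)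
          obtain ⟨b', c, c', e, e'⟩ := exists_gen_lie (!a.1) j.1 m (-j.2)
          rw [hy, e, e' (by omega), zero_smul, add_zero, smul_lie]
          refine Submodule.smul_mem _ _ ?_
          have := gen_lie_word hχ hχ₀ l p b' (m + -j.2) (by omega)
          rw [hχ₀ _ _ (by omega), zero_smul, sub_zero] at this
          exact filt_mono w (by rw [wt_cons]; push_cast; omega) this
      rw [List.erase_cons_tail (by simpa using hja), List.count_cons_of_ne hja]
      convert add_mem ih' h1 using 1
      abel

/-- The union of the filtration contains `w` and is stable under every generator, the positive ones
by `gen_lie_filt`. -/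
theorem exists_mem_filt (hw : LieSubmodule.lieSpan ℂ Alg {w} = ⊤) (v : V) :
    ∃ d : ℕ, v ∈ filt w d := by
  have hv : v ∈ LieSubmodule.lieSpan ℂ Alg {w} := by rw [hw]; trivial
  induction hv using LieSubmodule.lieSpan_induction with
  | mem v hv =>
    obtain rfl : v = w := hv
    exact ⟨0, mem_filt_zero v⟩
  | zero => exact ⟨0, zero_mem _⟩
  | add u v _ _ hu hv =>
    obtain ⟨d, hu⟩ := hu
    obtain ⟨e, hv⟩ := hv
    exact ⟨d + e, add_mem (filt_mono w (by omega) hu) (filt_mono w (by omega) hv)⟩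
  | smul c v _ hv => exact hv.imp fun _ h => Submodule.smul_mem _ _ h
  | lie x v _ hv =>
    obtain ⟨d, hv⟩ := hv
    induction x using alg_induction with
    | hgen b n =>
      rcases lt_or_ge 0 n with hn | hn
      · refine ⟨d, ?_⟩
        have := add_mem (filt_mono w (by omega) (gen_lie_filt hχ hχ₀ b n hn hv))
          (Submodule.smul_mem _ (χ b n) hv)
        rwa [sub_add_cancel] at this
      · obtain ⟨k, rfl⟩ := Int.exists_eq_neg_ofNat hn
        exact ⟨d + k + 2, gen_neg_mem_filt w (b, k) hv (by push_cast; omega)⟩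
    | hz => exact ⟨d, zEnd_mem_filt w hv⟩
    | h0 => exact ⟨0, by rw [zero_lie]; exact zero_mem _⟩
    | hadd x y hx hy =>
      obtain ⟨d, hx⟩ := hx
      obtain ⟨e, hy⟩ := hy
      exact ⟨d + e, by
        rw [add_lie]
        exact add_mem (filt_mono w (by omega) hx) (filt_mono w (by omega) hy)⟩
    | hsmul c x hx => exact hx.imp fun _ h => by rw [smul_lie]; exact Submodule.smul_mem _ _ h

/-- Every nonzero submodule contains a nonzero vector on which positive generators act as on
`w`. -/
theorem exists_common_eigenvector (hw : LieSubmodule.lieSpan ℂ Alg {w} = ⊤)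
    (N : LieSubmodule ℂ Alg V) (hN : N ≠ ⊥) :
    ∃ v ∈ N, v ≠ 0 ∧ ∀ b n, 0 < n → ⁅gen b n, v⁆ = χ b n • v := by
  obtain ⟨u, hu, hu0⟩ := Submodule.exists_mem_ne_zero_of_ne_bot
    (mt (LieSubmodule.toSubmodule_eq_bot N).1 hN)
  -- A vector of least weight works: `gen b n - χ b n` preserves `N` and strictly lowers weight, so
  -- it must kill that vector.
  have hex : ∃ d : ℕ, ∃ v ∈ N, v ≠ 0 ∧ v ∈ filt w d := by
    obtain ⟨d, hd⟩ := exists_mem_filt hχ hχ₀ hw u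
    exact ⟨d, u, hu, hu0, hd⟩
  classical
  obtain ⟨v, hv, hv0, hvd⟩ := Nat.find_spec hex
  refine ⟨v, hv, hv0, fun b n hn => sub_eq_zero.1 ?_⟩
  by_contra h
  have hf := gen_lie_filt hχ hχ₀ b n hn hvd
  rcases Nat.eq_zero_or_pos (Nat.find hex) with h0 | h0
  · rw [filt_eq_bot w (by omega)] at hf
    exact h hf
  · refine Nat.find_min hex (Nat.sub_one_lt_of_lt h0)
      ⟨_, N.sub_mem (N.lie_mem hv) (N.smul_mem _ hv), h, filt_mono w (by omega) hf⟩

/-- A combination of words of weight `d` that lies in `N` up to words of smaller weight has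
all its coefficients `p` subject to `p(z) w ∈ N`. -/
theorem coeff_mem (hχ₂ : χ false 2 ≠ 0) (N : LieSubmodule ℂ Alg V) (d : ℕ) :
    ∀ (A : Finset (Multiset (Bool × ℕ))) (p : Multiset (Bool × ℕ) → ℂ[X]),
      (∀ s ∈ A, wt s.toList = d) →
      ∑ s ∈ A, word s.toList (aeval (zEnd V) (p s) w) ∈ (N : Submodule ℂ V) ⊔ filt w (d - 1) →
      ∀ s ∈ A, aeval (zEnd V) (p s) w ∈ N := by
  classical
  induction d using Nat.strong_induction_on with
  | _ d ih =>
  intro A p hA hsum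
  by_contra! hcon
  -- Terms whose coefficient already satisfies the claim have their words in `N` and can be
  -- discarded.
  set B := A.filter fun s => aeval (zEnd V) (p s) w ∉ N with hB
  have hBA : ∀ s ∈ B, s ∈ A := fun s hs => (Finset.mem_filter.1 hs).1
  have hBN : ∀ s ∈ B, aeval (zEnd V) (p s) w ∉ N := fun s hs => (Finset.mem_filter.1 hs).2
  have hBne : B.Nonempty := by
    obtain ⟨s, hs, hs'⟩ := hcon
    exact ⟨s, Finset.mem_filter.2 ⟨hs, hs'⟩⟩
  have hsumB : ∑ s ∈ B, word s.toList (aeval (zEnd V) (p s) w) ∈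
      (N : Submodule ℂ V) ⊔ filt w (d - 1) := by
    rw [← Finset.sum_filter_add_sum_filter_not A fun s => aeval (zEnd V) (p s) w ∉ N] at hsum
    refine (Submodule.add_mem_iff_left _ (Submodule.mem_sup_left (sum_mem fun s hs => ?_))).1 hsum
    exact word_mem N _ (not_not.1 (Finset.mem_filter.1 hs).2)
  rcases Nat.eq_zero_or_pos d with rfl | hd
  · obtain ⟨s, hs⟩ := hBne
    have h0 : ∀ t ∈ B, t = 0 := fun t ht => by
      have := hA t (hBA t ht)
      rw [← Multiset.toList_eq_nil]
      cases h : t.toList with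
      | nil => rfl
      | cons j l => rw [h, wt_cons] at this; omega
    have hB0 : B = {0} := Finset.eq_singleton_iff_unique_mem.2 ⟨h0 s hs ▸ hs, h0⟩
    have hs0 := hBN 0 (h0 s hs ▸ hs)
    rw [hB0, Finset.sum_singleton, filt_eq_bot w (by simp), sup_bot_eq, Multiset.toList_zero,
      word_nil] at hsumB
    exact hs0 hsumB
  · have hQ : (B.biUnion Multiset.toFinset).Nonempty := by
      obtain ⟨s, hs⟩ := hBne
      have hs' : s ≠ 0 := by
        rintro rfl
        have := hA 0 (hBA 0 hs)
        rw [Multiset.toList_zero, wt_nil] at this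
        omega
      obtain ⟨j, hj⟩ := Multiset.exists_mem_of_ne_zero hs'
      exact ⟨j, Finset.mem_biUnion.2 ⟨s, hs, Multiset.mem_toFinset.2 hj⟩⟩
    obtain ⟨a, ha, hmax⟩ := Finset.exists_max_image _ toLex hQ
    have hle : ∀ s ∈ B, ∀ j ∈ s, toLex j ≤ toLex a := fun s hs j hj =>
      hmax j (Finset.mem_biUnion.2 ⟨s, hs, Multiset.mem_toFinset.2 hj⟩)
    obtain ⟨s₀, hs₀, has₀⟩ := Finset.mem_biUnion.1 ha
    rw [Multiset.mem_toFinset] at has₀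
    set D := B.filter fun s => a ∈ s with hD
    have hDB : ∀ s ∈ D, s ∈ B := fun s hs => (Finset.mem_filter.1 hs).1
    have hDa : ∀ s ∈ D, a ∈ s := fun s hs => (Finset.mem_filter.1 hs).2
    set C : ℂ := -(2 * a.2 + 2) * χ false 2 with hC
    have hC0 : C ≠ 0 := mul_ne_zero
      (neg_ne_zero.2 (by exact_mod_cast Nat.succ_ne_zero (2 * a.2 + 1))) hχ₂
    have hperm : ∀ s : Multiset (Bool × ℕ), (s.toList.erase a).Perm (s.erase a).toList :=
      fun s => by
        rw [← Multiset.coe_eq_coe, Multiset.coe_toList]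
        conv_rhs => rw [← Multiset.coe_toList s, Multiset.coe_erase]
        congr!
    have hcount : ∀ s : Multiset (Bool × ℕ), s.toList.count a = s.count a := fun s => by
      conv_rhs => rw [← Multiset.coe_toList s, Multiset.coe_count]
      congr!
    have hwt : ∀ s ∈ D, a.2 + 2 + wt (s.erase a).toList = d := fun s hs => by
      rw [← wt_cons, ← hA s (hBA s (hDB s hs))]
      refine wt_perm (Multiset.coe_eq_coe.1 ?_)
      rw [← Multiset.cons_coe, Multiset.coe_toList, Multiset.coe_toList,
        Multiset.cons_erase (hDa s hs)]
    -- Erasing `a` merges no two terms, so each differentiated coefficient is a nonzero multiple of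
    -- a single `p s`.
    have hinj : Set.InjOn (fun s : Multiset (Bool × ℕ) => s.erase a) D := fun s hs t ht h => by
      rw [← Multiset.cons_erase (hDa s hs), ← Multiset.cons_erase (hDa t ht)]
      exact congrArg _ h
    set p' : Multiset (Bool × ℕ) → ℂ[X] := fun t =>
      (((a ::ₘ t).count a : ℂ) * C) • p (a ::ₘ t) with hp'
    have hp's : ∀ s ∈ D, aeval (zEnd V) (p' (s.erase a)) w =
        ((s.count a : ℂ) * C) • aeval (zEnd V) (p s) w := fun s hs => by
      rw [hp']
      simp only [Multiset.cons_erase (hDa s hs), map_smul, LinearMap.smul_apply]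
    have hlead : ∀ s ∈ B, ⁅gen (!a.1) (a.2 + 2), word s.toList (aeval (zEnd V) (p s) w)⁆
        - χ (!a.1) (a.2 + 2) • word s.toList (aeval (zEnd V) (p s) w)
        - ((s.count a : ℂ) * C) • word (s.erase a).toList (aeval (zEnd V) (p s) w)
        ∈ filt w (d - (a.2 + 2) - 1) := fun s hs => by
      have h1 := gen_lie_word_leading hχ hχ₀ a s.toList
        (fun j hj => hle s hs j (Multiset.mem_toList.1 hj)) (p s)
      rw [hA s (hBA s hs), hcount] at h1
      by_cases has : a ∈ s
      · have h2 := word_perm w (hperm s) (p s)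
        have hsD : s ∈ D := Finset.mem_filter.2 ⟨hs, has⟩
        have h3 := filt_mono w (e := d - (a.2 + 2) - 1)
          (by have := hwt s hsD; rw [wt_perm (hperm s)]; omega) h2
        convert add_mem h1 (Submodule.smul_mem _ ((s.count a : ℂ) * C) h3) using 1
        module
      · rw [Multiset.count_eq_zero_of_notMem has] at h1 ⊢
        simpa using h1
    have hkey : ∑ t ∈ D.image fun s => s.erase a, word t.toList (aeval (zEnd V) (p' t) w) ∈
        (N : Submodule ℂ V) ⊔ filt w ((d - (a.2 + 2) : ℕ) - 1) := by
      rw [Finset.sum_image hinj]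
      have e1 : ∑ s ∈ D, word (s.erase a).toList (aeval (zEnd V) (p' (s.erase a)) w) =
          ∑ s ∈ B, ((s.count a : ℂ) * C) • word (s.erase a).toList (aeval (zEnd V) (p s) w) := by
        rw [hD, Finset.sum_filter]
        refine Finset.sum_congr rfl fun s hs => ?_
        split_ifs with has
        · rw [hp's s (Finset.mem_filter.2 ⟨hs, has⟩), word_smul]
        · simp [Multiset.count_eq_zero_of_notMem has]
      have hd' : ((d - (a.2 + 2) : ℕ) : ℤ) - 1 = d - (a.2 + 2) - 1 := by
        have := hwt s₀ (Finset.mem_filter.2 ⟨hs₀, has₀⟩)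
        omega
      rw [e1, hd']
      have h1 := sum_mem hlead
      rw [Finset.sum_sub_distrib, Finset.sum_sub_distrib, ← Finset.smul_sum, ← lie_sum] at h1
      set v := ∑ s ∈ B, word s.toList (aeval (zEnd V) (p s) w) with hv
      -- The operator preserves `N` and lowers the weight of `f` by `a.2 + 2`, so the hypothesis
      -- passes to the differentiated sum.
      obtain ⟨n, hn, f, hf, hnf⟩ := Submodule.mem_sup.1 hsumB
      have h2 := gen_lie_filt hχ hχ₀ (!a.1) (a.2 + 2) (by omega) hf
      have h3 : ⁅gen (!a.1) (a.2 + 2), n⁆ - χ (!a.1) (a.2 + 2) • n ∈ (N : Submodule ℂ V) :=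
        N.sub_mem (N.lie_mem hn) (N.smul_mem _ hn)
      refine Submodule.mem_sup.2 ⟨_, h3, _, sub_mem (filt_mono w (by omega) h2) h1, ?_⟩
      rw [← hnf, lie_add]
      module
    have hs₀D : s₀ ∈ D := Finset.mem_filter.2 ⟨hs₀, has₀⟩
    have := ih (d - (a.2 + 2)) (by omega) _ p' (fun t ht => by
      obtain ⟨s, hs, rfl⟩ := Finset.mem_image.1 ht
      have := hwt s hs
      omega) hkey (s₀.erase a) (Finset.mem_image_of_mem _ hs₀D)
    rw [hp's s₀ hs₀D] at this
    refine hBN s₀ hs₀ ?_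
    have hc : (s₀.count a : ℂ) * C ≠ 0 :=
      mul_ne_zero (Nat.cast_ne_zero.2 (Multiset.count_pos.2 has₀).ne') hC0
    exact (N.toSubmodule.smul_mem_iff hc).1 this

/-- Every submodule `N` is of the form `I V`, for the ideal `I` of all `p` with `p(z) w ∈ N`. -/
theorem exists_ideal (hw : LieSubmodule.lieSpan ℂ Alg {w} = ⊤) (hχ₂ : χ false 2 ≠ 0)
    (N : LieSubmodule ℂ Alg V) :
    ∃ I : Ideal ℂ[X], (N : Submodule ℂ V) =
      Submodule.span ℂ {m | ∃ p ∈ I, ∃ v : V, m = aeval (zEnd V) p v} := by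
  let I : Ideal ℂ[X] :=
    { carrier := {p | aeval (zEnd V) p w ∈ N}
      add_mem' := fun {p q} hp hq => by
        change aeval (zEnd V) (p + q) w ∈ N
        rw [map_add]; exact N.add_mem hp hq
      zero_mem' := by
        change aeval (zEnd V) 0 w ∈ N
        rw [map_zero]; exact N.zero_mem
      smul_mem' := fun q p hp => by
        change aeval (zEnd V) (q * p) w ∈ N
        rw [map_mul]; exact aeval_zEnd_mem N q hp }
  refine ⟨I, le_antisymm (fun v hv => ?_) (Submodule.span_le.2 ?_)⟩
  -- The index `d - 1` makes the base case the zero space.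
  · have key : ∀ d : ℕ, ∀ v ∈ N, v ∈ filt w (d - 1) →
        v ∈ Submodule.span ℂ {m | ∃ p ∈ I, ∃ v : V, m = aeval (zEnd V) p v} := by
      intro d
      induction d with
      | zero =>
        intro v _ hv
        rw [filt_eq_bot w (by simp)] at hv
        rw [(Submodule.mem_bot ℂ).1 hv]
        exact zero_mem _
      | succ d ih =>
        intro v hvN hv
        rw [Nat.cast_succ, add_sub_cancel_right] at hv
        obtain ⟨A, p, hA, h⟩ := exists_sum_words w d hv
        -- The leading sum lies in both `N` and `I V`; subtracting it leaves an element of `N` of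
        -- smaller weight.
        have hI := coeff_mem hχ hχ₀ hχ₂ N d A p hA
          (Submodule.mem_sup.2 ⟨v, hvN, _, neg_mem h, by abel⟩)
        rw [← sub_add_cancel v (∑ s ∈ A, word s.toList (aeval (zEnd V) (p s) w))]
        refine add_mem (ih _ (N.sub_mem hvN ?_) h) (sum_mem fun s hs => ?_)
        · exact (N : Submodule ℂ V).sum_mem fun s hs => word_mem N _ (hI s hs)
        · exact Submodule.subset_span ⟨p s, hI s hs, _, (aeval_zEnd_word _ _ _).symm⟩
    obtain ⟨d, hd⟩ := exists_mem_filt hχ hχ₀ hw v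
    exact key (d + 1) v hv (filt_mono w (by push_cast; omega) hd)
  · rintro _ ⟨p, hp, v, rfl⟩
    have hv : v ∈ LieSubmodule.lieSpan ℂ Alg {w} := by rw [hw]; trivial
    change aeval (zEnd V) p v ∈ N
    induction hv using LieSubmodule.lieSpan_induction with
    | mem v hv => rw [Set.mem_singleton_iff.1 hv]; exact hp
    | zero => rw [map_zero]; exact N.zero_mem
    | add u v _ _ hu hv => rw [map_add]; exact N.add_mem hu hv
    | smul c v _ hv => rw [map_smul]; exact N.smul_mem c hv
    | lie x v _ hv => rw [aeval_zEnd_lie]; exact N.lie_mem hv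

end Whittaker

end Words

/-! ### Characters of the positive part, and statement (1) -/

section Character

variable (φ : LieAlgebra.LieCharacter ℂ Pos)

theorem gen_mem_pos (b : Bool) {n : ℤ} (hn : 0 < n) : gen b n ∈ Pos := by
  cases b
  · exact (posW n hn).2
  · exact (posL n hn).2

/-- The values of `φ` on the generators of positive degree, extended by zero. -/
def charGen (b : Bool) (n : ℤ) : ℂ := if hn : 0 < n then φ ⟨gen b n, gen_mem_pos b hn⟩ else 0

theorem charGen_of_pos (b : Bool) {n : ℤ} (hn : 0 < n) :
    charGen φ b n = φ ⟨gen b n, gen_mem_pos b hn⟩ := dif_pos hn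

/-- A character kills `⁅L 1, gen b (n - 1)⁆ = (n - 2) • gen b n`, and `n - 2` is nonzero here. -/
theorem charGen_eq_zero (b : Bool) (n : ℤ) (hn : 3 ≤ n) : charGen φ b n = 0 := by
  have h : (⁅posL 1 one_pos, (⟨gen b (n - 1), gen_mem_pos b (by omega)⟩ : Pos)⁆ : Pos) =
      ((n : ℂ) - 2) • ⟨gen b n, gen_mem_pos b (by omega)⟩ := by
    apply Subtype.ext
    change ⁅L 1, gen b (n - 1)⁆ = ((n : ℂ) - 2) • gen b n
    have hc : cocycle 1 (n - 1) = 0 := if_neg (by omega)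
    cases b <;>
    · simp only [gen, L, W, vec_lie, bracketBasis, hc, zero_smul, add_zero, if_true, if_false,
        Bool.false_eq_true, sub_add_cancel]
      congr 1
      push_cast
      ring
  have h2 := congrArg φ h
  rw [LieAlgebra.lieCharacter_apply_lie, map_smul, smul_eq_mul, eq_comm, mul_eq_zero] at h2
  rw [charGen_of_pos φ b (by omega)]
  refine h2.resolve_left (sub_ne_zero.2 ?_)
  exact_mod_cast (by omega : n ≠ 2)

variable {φ} {V : Type*} [AddCommGroup V] [Module ℂ V] [LieRingModule Alg V] [LieModule ℂ Alg V]

theorem isWhittakerVector_iff {v : V} :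
    IsWhittakerVector φ v ↔ ∀ b n, 0 < n → ⁅gen b n, v⁆ = charGen φ b n • v := by
  constructor
  · intro h b n hn
    rw [charGen_of_pos φ b hn]
    exact h ⟨gen b n, gen_mem_pos b hn⟩
  · rintro h ⟨x, hx⟩
    change x ∈ Submodule.span ℂ _ at hx
    induction hx using Submodule.span_induction with
    | mem x hx =>
      obtain ⟨n, hn, rfl | rfl⟩ := hx
      · exact (h true n hn).trans (by rw [charGen_of_pos φ true hn]; rfl)
      · exact (h false n hn).trans (by rw [charGen_of_pos φ false hn]; rfl)
    | zero => exact (zero_lie v).trans (by rw [← zero_smul ℂ v, ← map_zero φ]; rfl)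
    | add x y hx hy h₁ h₂ =>
      exact (add_lie x y v).trans (by
        rw [h₁, h₂, ← add_smul, ← map_add]; rfl)
    | smul c x hx h₁ =>
      refine (smul_lie c x v).trans ?_
      rw [h₁, smul_smul, ← smul_eq_mul, ← map_smul]; rfl

omit [LieModule ℂ Alg V] in
theorem IsWhittakerVector.of_coe {N : LieSubmodule ℂ Alg V} {v : N}
    (h : IsWhittakerVector φ (v : V)) : IsWhittakerVector φ v := fun x => Subtype.ext (h x)

theorem exists_whittaker_submodule (h : IsWhittakerModule V φ) (N : LieSubmodule ℂ Alg V)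
    (hN : N ≠ ⊥) : ∃ N' : LieSubmodule ℂ Alg V, N' ≤ N ∧ N' ≠ ⊥ ∧ IsWhittakerModule N' φ := by
  obtain ⟨hφ, w, hw, hspan⟩ := h
  obtain ⟨v, hv, hv0, hvφ⟩ := exists_common_eigenvector (isWhittakerVector_iff.1 hw)
    (charGen_eq_zero φ) hspan N hN
  have hmem : v ∈ LieSubmodule.lieSpan ℂ Alg {v} := LieSubmodule.subset_lieSpan rfl
  refine ⟨LieSubmodule.lieSpan ℂ Alg {v}, ?_, ?_, hφ, ⟨v, hmem⟩,
    IsWhittakerVector.of_coe (isWhittakerVector_iff.2 hvφ), ?_⟩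
  · exact LieSubmodule.lieSpan_le.2 (Set.singleton_subset_iff.2 hv)
  · exact fun h => hv0 ((LieSubmodule.mem_bot v).1 (h ▸ hmem))
  · refine eq_top_iff.2 ?_
    rintro ⟨u, hu⟩ -
    induction hu using LieSubmodule.lieSpan_induction with
    | mem u hu =>
      obtain rfl : u = v := hu
      exact LieSubmodule.subset_lieSpan rfl
    | zero => exact zero_mem _
    | add x y hx hy h₁ h₂ => exact add_mem h₁ h₂
    | smul c x hx h₁ => exact (LieSubmodule.lieSpan ℂ Alg _).toSubmodule.smul_mem c h₁
    | lie x u hu h₁ => exact LieSubmodule.lie_mem _ h₁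

end Character

/-! ### The induced module `M_φ`, and statement (2) -/

section Universal

variable (φ : LieAlgebra.LieCharacter ℂ Pos)

/-- The generator `1 ⊗ 1` of `M_φ`. -/
def universalGen : Universal φ := (tensorRel φ).mkQ (1 ⊗ₜ 1)

theorem isWhittakerVector_universalGen : IsWhittakerVector φ (universalGen φ) := by
  intro x
  have h1 : (1 * inclU (UniversalEnvelopingAlgebra.ι ℂ x)) ⊗ₜ[ℂ] (1 : ℂ)
      - 1 ⊗ₜ[ℂ] (charU φ (UniversalEnvelopingAlgebra.ι ℂ x) * 1) ∈ tensorRel φ :=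
    Submodule.subset_span ⟨1, _, 1, rfl⟩
  have h2 : inclU (UniversalEnvelopingAlgebra.ι ℂ x) = ι (x : Alg) := by
    simp [inclU]
  have h3 : charU φ (UniversalEnvelopingAlgebra.ι ℂ x) = φ x := by
    simp [charU]
  rw [h2, h3, one_mul, mul_one] at h1
  have h4 := (Submodule.Quotient.eq _).2 h1
  change (tensorRel φ).mkQ (ι (x : Alg) • (1 ⊗ₜ 1)) = (tensorRel φ).mkQ (φ x • (1 ⊗ₜ 1))
  rw [TensorProduct.smul_tmul', smul_eq_mul, mul_one, TensorProduct.smul_tmul',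
    TensorProduct.smul_tmul, smul_eq_mul, mul_one]
  exact h4

variable {φ} in
-- The elements of `U` stabilising `N` form a subalgebra through which `ι` factors; by the universal
-- property the identity of `U` factors through it too.
theorem smul_mem_of_lieSubmodule (N : LieSubmodule ℂ Alg (Universal φ)) (u : U)
    {m : Universal φ} (hm : m ∈ N) : u • m ∈ N := by
  let S : Subalgebra ℂ U :=
    { carrier := {u | ∀ m ∈ N, u • m ∈ N}
      mul_mem' := fun {a b} ha hb m hm => by rw [mul_smul]; exact ha _ (hb m hm)
      add_mem' := fun {a b} ha hb m hm => by rw [add_smul]; exact N.add_mem (ha m hm) (hb m hm)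
      algebraMap_mem' := fun c m hm => by rw [algebraMap_smul]; exact N.smul_mem c hm }
  let f : Alg →ₗ⁅ℂ⁆ S :=
    { toFun := fun x => ⟨ι x, fun m hm => N.lie_mem hm⟩
      map_add' := fun x y => Subtype.ext (map_add ι x y)
      map_smul' := fun c x => Subtype.ext (map_smul ι c x)
      map_lie' := fun {x y} => Subtype.ext (LieHom.map_lie ι x y) }
  have h : S.val.comp (UniversalEnvelopingAlgebra.lift ℂ f) = AlgHom.id ℂ U := by
    apply UniversalEnvelopingAlgebra.hom_ext
    ext x
    simp [f]
  have hu : u ∈ S := by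
    have := AlgHom.congr_fun h u
    rw [AlgHom.id_apply] at this
    rw [← this]
    exact (UniversalEnvelopingAlgebra.lift ℂ f u).2
  exact hu m hm

theorem lieSpan_universalGen : LieSubmodule.lieSpan ℂ Alg {universalGen φ} = ⊤ := by
  refine eq_top_iff.2 fun m _ => ?_
  obtain ⟨t, rfl⟩ := (tensorRel φ).mkQ_surjective m
  induction t using TensorProduct.induction_on with
  | zero => rw [map_zero]; exact zero_mem _
  | add s t hs ht => rw [map_add]; exact add_mem (hs trivial) (ht trivial)
  | tmul u c =>
    have h : (tensorRel φ).mkQ (u ⊗ₜ c) = ((c • u) • universalGen φ : Universal φ) := by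
      change _ = (tensorRel φ).mkQ ((c • u) • (1 ⊗ₜ 1))
      rw [TensorProduct.smul_tmul', smul_eq_mul, mul_one, TensorProduct.smul_tmul, smul_eq_mul,
        mul_one]
    rw [h]
    exact smul_mem_of_lieSubmodule _ _ (LieSubmodule.subset_lieSpan rfl)

theorem aeval_smul_universal (p : Polynomial ℂ) (v : Universal φ) :
    aeval (ι z) p • v = aeval (zEnd (Universal φ)) p v := by
  induction p using Polynomial.induction_on' with
  | add p q hp hq => rw [map_add, map_add, add_smul, hp, hq, LinearMap.add_apply]
  | monomial n a =>
    rw [aeval_monomial, aeval_monomial, mul_smul, algebraMap_smul, Module.End.mul_apply,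
      Module.algebraMap_end_apply]
    congr 1
    induction n with
    | zero => simp
    | succ n ih => rw [pow_succ', pow_succ', mul_smul, ih]; rfl

theorem exists_eq_idealMul (hφ : NonSingular φ) (N : LieSubmodule ℂ Alg (Universal φ)) :
    ∃ I : Ideal (Polynomial ℂ), (N : Submodule ℂ (Universal φ)) = idealMul φ I := by
  have h2 : charGen φ false 2 ≠ 0 := by
    rw [charGen_of_pos φ false two_pos]
    exact right_ne_zero_of_mul hφ.2
  obtain ⟨I, hI⟩ := exists_ideal (isWhittakerVector_iff.1 (isWhittakerVector_universalGen φ))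
    (charGen_eq_zero φ) (lieSpan_universalGen φ) h2 N
  refine ⟨I, hI.trans ?_⟩
  simp only [idealMul, aeval_smul_universal]

end Universal

end W22

end
theorem proposition4p1 (φ : LieAlgebra.LieCharacter ℂ W22.Pos) (hφ : W22.NonSingular φ) :
    (∀ (V : Type*) [AddCommGroup V] [Module ℂ V] [LieRingModule W22.Alg V]
        [LieModule ℂ W22.Alg V],
      W22.IsWhittakerModule V φ →
        ∀ N : LieSubmodule ℂ W22.Alg V, N ≠ ⊥ →
          ∃ N' : LieSubmodule ℂ W22.Alg V, N' ≤ N ∧ N' ≠ ⊥ ∧ W22.IsWhittakerModule N' φ) ∧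
    (∀ N : LieSubmodule ℂ W22.Alg (W22.Universal φ),
      ∃ I : Ideal (Polynomial ℂ), (N : Submodule ℂ (W22.Universal φ)) = W22.idealMul φ I) :=
  ⟨fun _ _ _ _ _ h N hN => W22.exists_whittaker_submodule h N hN,
    W22.exists_eq_idealMul φ hφ⟩
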